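/- A $(+,\circ)$-structure is a non-empty set equipped with two binary operations $+$ and $\circ$. For binary relations $R,S\subseteq X\times X$ on a set $X$ let $\mathrm{d}(R)=\{x\in X:\exists y\,(x,y)\in R\}$, let $$R\sqcup S=\{(x,y)\in R\cup S: x\in \mathrm{d}(R)\cap \mathrm{d}(S)\}$$ be their demonic join, and let $$R;S=\{(x,z)\in X\times X:\exists y\,((x,y)\in R\wedge (y,z)\in S)\}$$ be their ordinary composition. A $(+,\circ)$-structure is $(\sqcup,;)$-representable if it is isomorphic to a structure whose elements are binary relations on some set $X$, forming a set closed under $\sqcup$ and $;$, where $+$ is interpreted as $\sqcup$ and $\circ$ as $;$. Let $R(\sqcup,;)$ be the class of all $(\sqcup,;)$-representable structures. **Theorem.** $R(\sqcup,;)$ is not finitely axiomatisable: there is no finite set $\Psi$ of first-order sentences in the signature $(+,\circ)$ such that, for every $(+,\circ)$-structure $\mathcal S$, $\mathcal S\models\Psi$ if and only if $\mathcal S\in R(\sqcup,;)$. -/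

import Mathlib

open FirstOrder

universe u

namespace DemonicJoin

/-- The two binary function symbols: abstract join `+` and abstract composition `∘`. -/
inductive Op : ℕ → Type
  | add : Op 2
  | comp : Op 2

/-- The first-order language of `(+, ∘)`-structures: two binary function symbols
and no relation symbols (equality is logical). -/
def Lang : FirstOrder.Language.{0, 0} := ⟨Op, fun _ => Empty⟩

/-- Binary relations over the base `X`, as sets of pairs. -/
abbrev BinRel (X : Type*) := Set (X × X)

namespace BinRel

variable {X : Type*}

/-- The domain `d(R)` of a relation. -/
def dom (R : BinRel X) : Set X := {x | ∃ y, (x, y) ∈ R}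

/-- Restriction of a relation to the pairs whose first coordinate lies in `A`. -/
def restrict (R : BinRel X) (A : Set X) : BinRel X := {q | q ∈ R ∧ q.1 ∈ A}

/-- Demonic join: `R ⊔ S` is `R ∪ S` restricted to `d(R) ∩ d(S)`. -/
def demonicJoin (R S : BinRel X) : BinRel X := restrict (R ∪ S) (dom R ∩ dom S)

/-- Ordinary (angelic) composition `R ; S`. -/
def comp (R S : BinRel X) : BinRel X := {q | ∃ y, (q.1, y) ∈ R ∧ (y, q.2) ∈ S}

/-- The algebra of all binary relations over `X`: `+` is demonic join, `∘` is ordinary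
composition. -/
instance fullStructure : Lang.Structure (BinRel X) where
  funMap {_} f :=
    match f with
    | Op.add => fun v => demonicJoin (v 0) (v 1)
    | Op.comp => fun v => comp (v 0) (v 1)
  RelMap {_} r := r.elim

end BinRel

/-- A `(+, ∘)`-structure is representable if it is isomorphic to a proper structure, that is, to a
set of binary relations over some base `X` closed under demonic join and ordinary composition,
with these as its operations. -/
def Representable (S : Type u) [Lang.Structure S] : Prop :=
  ∃ (X : Type u) (P : Lang.Substructure (BinRel X)), Nonempty (S ≃[Lang] P)

end DemonicJoin

/-!
Each `ZigzagStructure n` with `0 < n` violates a quasi-identity that holds in all representable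
structures. It has a zero and atoms `e i` such that `e (2 k) ∘ e (2 k + 1)` and
`e (2 k + 1) ∘ e (2 k)` for `k < n`, and also `e (2 n) ∘ e 0`, are zero, and `e 0` is below every
join `e (2 k + 1) + e (2 k + 2)`, but `e 0 ∘ e 0` is not zero. In a representation, a pair in
`e 0 ∘ e 0` outside the zero would come from two consecutive edges in `e 0`. Neither can be in
`e 1`, hence both are in `e 2`, hence neither is in `e 3`, and so on until both are in `e (2 n)`,
against `e (2 n) ∘ e 0` being zero.

If `k + 1 < n`, then any `k` elements omit some atom `e (2 t + 1)` with `0 < t < n`, and without it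
the chain breaks at step `t`: let both edges carry exactly the labels outside
`{1, 3, …, 2 t - 1} ∪ {2 t + 2, 2 t + 4, …}`. So every fixed number of elements is correctly
represented in all large `ZigzagStructure n`, and nonprincipal ultraproducts of these structures
are representable. By Łoś's theorem a finite axiomatisation would then hold in a nonrepresentable
factor.
-/

open FirstOrder.Language Filter Set

universe v

namespace DemonicJoin

section Ultraproducts

variable {ι : Type*} {M : ι → Type*} {U : Ultrafilter ι}

theorem eventually_out_eq_out_iff {a b : (U : Filter ι).Product M} :
    (∀ᶠ i in U, a.out i = b.out i) ↔ a = b :=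
  Quotient.out_equiv_out (s := (U : Filter ι).productSetoid M)

theorem eventually_injOn_out (F : Finset ((U : Filter ι).Product M)) :
    ∀ᶠ i in U, InjOn (fun a : (U : Filter ι).Product M => a.out i) F := by
  simp only [InjOn, Finset.mem_coe, Finset.eventually_all, Ultrafilter.eventually_imp,
    eventually_out_eq_out_iff, eventually_const, imp_self, implies_true]

variable {L : FirstOrder.Language} [∀ i, L.Structure (M i)]

theorem eventually_model_of_finite [∀ i, Nonempty (M i)] {T : L.Theory} (hT : T.Finite)
    (h : (U : Filter ι).Product M ⊨ T) : ∀ᶠ i in U, M i ⊨ T := by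
  simp only [Theory.model_iff, eventually_all_finite hT] at h ⊢
  exact fun φ hφ => (Ultraproduct.sentence_realize φ).1 (h φ hφ)

theorem eventually_out_funMap {k : ℕ} (f : L.Functions k) (v : Fin k → (U : Filter ι).Product M) :
    ∀ᶠ i in U, (Structure.funMap f v).out i = Structure.funMap f fun j => (v j).out i := by
  have hv : (fun j => ((v j).out : (U : Filter ι).Product M)) = v := funext fun j => (v j).out_eq
  have h := Ultraproduct.funMap_cast (u := U) f fun j => (v j).out
  rw [hv] at h
  exact Quotient.exact (s := (U : Filter ι).productSetoid M) ((Quotient.out_eq _).trans h)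

end Ultraproducts

namespace BinRel

section Ultraproduct

variable {ι : Type*} {X : ι → Type*} {U : Ultrafilter ι}

/-- The relation on the product of the bases that holds when almost all coordinates are related.
It is not passed to the quotient modulo `U`, since representations do not need it. -/
def ultraproduct (U : Ultrafilter ι) (R : ∀ i, BinRel (X i)) : BinRel (∀ i, X i) :=
  {q | ∀ᶠ i in U, (q.1 i, q.2 i) ∈ R i}

variable [∀ i, Nonempty (X i)] {R R' : ∀ i, BinRel (X i)}

theorem ultraproduct_eq_ultraproduct_iff :
    ultraproduct U R = ultraproduct U R' ↔ ∀ᶠ i in U, R i = R' i := by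
  refine ⟨fun h => ?_, fun h => ?_⟩
  · by_contra hne
    have hdiff : ∀ᶠ i in U, ∃ q, ¬ (q ∈ R i ↔ q ∈ R' i) := by
      simpa only [← Ultrafilter.eventually_not, Set.ext_iff, not_forall] using hne
    obtain ⟨q, hq⟩ := skolem.1 hdiff
    have hiff : (∀ᶠ i in U, q i ∈ R i) ↔ ∀ᶠ i in U, q i ∈ R' i :=
      Set.ext_iff.1 h (fun i => (q i).1, fun i => (q i).2)
    rw [Ultrafilter.eventually_not] at hq
    simp only [iff_iff_implies_and_implies, eventually_and, Ultrafilter.eventually_imp] at hq hiff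
    exact hq hiff
  · ext ⟨x, y⟩
    exact eventually_congr (h.mono fun i hi => by rw [hi])

theorem mem_dom_ultraproduct {x : ∀ i, X i} :
    x ∈ dom (ultraproduct U R) ↔ ∀ᶠ i in U, x i ∈ dom (R i) :=
  (skolem (P := fun i y => (x i, y) ∈ R i)).symm

theorem ultraproduct_demonicJoin :
    ultraproduct U (fun i => demonicJoin (R i) (R' i)) =
      demonicJoin (ultraproduct U R) (ultraproduct U R') := by
  ext ⟨x, y⟩
  simp only [demonicJoin, restrict, mem_ofPred_eq, mem_inter_iff, mem_union, mem_dom_ultraproduct]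
  simp only [ultraproduct, mem_ofPred_eq, eventually_and, Ultrafilter.eventually_or]

theorem ultraproduct_comp :
    ultraproduct U (fun i => comp (R i) (R' i)) =
      comp (ultraproduct U R) (ultraproduct U R') := by
  ext ⟨x, z⟩
  simp only [comp, ultraproduct, mem_ofPred_eq, ← eventually_and]
  exact skolem

end Ultraproduct

theorem comp_self_subset_of_zigzag {X : Type*} {R : ℕ → BinRel X} {O : BinRel X} {n : ℕ}
    (hcover : ∀ k < n, R 0 ⊆ R (2 * k + 1) ∪ R (2 * k + 2))
    (heven : ∀ k < n, comp (R (2 * k)) (R (2 * k + 1)) ⊆ O)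
    (hodd : ∀ k < n, comp (R (2 * k + 1)) (R (2 * k)) ⊆ O)
    (hlast : comp (R (2 * n)) (R 0) ⊆ O) : comp (R 0) (R 0) ⊆ O := by
  rintro ⟨p, q⟩ ⟨r, hpr, hrq⟩
  by_contra hpq
  have climb : ∀ k ≤ n, (p, r) ∈ R (2 * k) ∧ (r, q) ∈ R (2 * k) := by
    intro k hk
    induction k with
    | zero => exact ⟨hpr, hrq⟩
    | succ k ih =>
      obtain ⟨hpr', hrq'⟩ := ih (by omega)
      exact ⟨(hcover k hk hpr).resolve_left fun h => hpq (hodd k hk ⟨r, h, hrq'⟩),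
        (hcover k hk hrq).resolve_left fun h => hpq (heven k hk ⟨r, hpr', h⟩)⟩
  exact hpq (hlast ⟨r, (climb n le_rfl).1, hrq⟩)

end BinRel

section Representations

variable {S T : Type*} [Lang.Structure S] [Lang.Structure T] {X : Type*}

/-- The abstract join `a + b` of a `(+, ∘)`-structure. -/
def join (a b : S) : S := Structure.funMap (L := Lang) Op.add ![a, b]

/-- The abstract composition `a ∘ b` of a `(+, ∘)`-structure. -/
def mul (a b : S) : S := Structure.funMap (L := Lang) Op.comp ![a, b]

theorem funMap_add (v : Fin 2 → S) : Structure.funMap (L := Lang) Op.add v = join (v 0) (v 1) :=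
  congrArg _ (List.ofFn_injective rfl)

theorem funMap_comp (v : Fin 2 → S) : Structure.funMap (L := Lang) Op.comp v = mul (v 0) (v 1) :=
  congrArg _ (List.ofFn_injective rfl)

/-- A map into relations that is injective on `F` and respects both operations at arguments
from `F`; the values of the operations may lie outside `F`. For `F = univ` these are the
representations, and for small finite `F` they are the local approximations from which
ultraproducts build representations. -/
structure IsRepresentationOn (F : Set S) (θ : S → BinRel X) : Prop where
  injOn : InjOn θ F
  map_join : ∀ a ∈ F, ∀ b ∈ F, θ (join a b) = BinRel.demonicJoin (θ a) (θ b)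
  map_mul : ∀ a ∈ F, ∀ b ∈ F, θ (mul a b) = BinRel.comp (θ a) (θ b)

theorem IsRepresentationOn.mono {E F : Set S} {θ : S → BinRel X} (hθ : IsRepresentationOn F θ)
    (h : E ⊆ F) : IsRepresentationOn E θ where
  injOn := hθ.injOn.mono h
  map_join a ha b hb := hθ.map_join a (h ha) b (h hb)
  map_mul a ha b hb := hθ.map_mul a (h ha) b (h hb)

theorem IsRepresentationOn.comp {F : Set S} {θ : T → BinRel X} {r : S → T}
    (hθ : IsRepresentationOn (r '' F) θ) (hr : InjOn r F)
    (hjoin : ∀ a ∈ F, ∀ b ∈ F, r (join a b) = join (r a) (r b))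
    (hmul : ∀ a ∈ F, ∀ b ∈ F, r (mul a b) = mul (r a) (r b)) : IsRepresentationOn F (θ ∘ r) where
  injOn := hθ.injOn.comp hr (mapsTo_image r F)
  map_join a ha b hb := (congrArg θ (hjoin a ha b hb)).trans
    (hθ.map_join _ (mem_image_of_mem r ha) _ (mem_image_of_mem r hb))
  map_mul a ha b hb := (congrArg θ (hmul a ha b hb)).trans
    (hθ.map_mul _ (mem_image_of_mem r ha) _ (mem_image_of_mem r hb))

theorem representable_iff {S : Type u} [Lang.Structure S] :
    Representable S ↔ ∃ (X : Type u) (θ : S → BinRel X), IsRepresentationOn univ θ := by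
  constructor
  · rintro ⟨X, P, ⟨e⟩⟩
    let f : S ↪[Lang] BinRel X := P.subtype.comp e.toEmbedding
    exact ⟨X, f, f.injective.injOn, fun a _ b _ => f.map_fun Op.add ![a, b],
      fun a _ b _ => f.map_fun Op.comp ![a, b]⟩
  · rintro ⟨X, θ, hθ⟩
    let f : S ↪[Lang] BinRel X :=
      { toFun := θ
        inj' := injOn_univ.1 hθ.injOn
        map_fun' := by
          rintro _ (_ | _) v
          · exact (congrArg θ (funMap_add v)).trans (hθ.map_join _ trivial _ trivial)
          · exact (congrArg θ (funMap_comp v)).trans (hθ.map_mul _ trivial _ trivial)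
        map_rel' := fun r _ => r.elim }
    exact ⟨X, f.toHom.range, ⟨f.equivRange⟩⟩

/-- The property that all sets of at most `k` elements have a partial representation. The bases
are nonempty so that products of bases have enough points. -/
def LocallyRepresentable (k : ℕ) (S : Type u) [Lang.Structure S] : Prop :=
  ∀ F : Finset S, F.card ≤ k →
    ∃ (X : Type u) (_ : Nonempty X) (θ : S → BinRel X), IsRepresentationOn (F : Set S) θ

theorem representable_of_forall_locallyRepresentable {S : Type u} [Lang.Structure S]
    (h : ∀ k, LocallyRepresentable k S) : Representable S := by
  classical
  choose X hX θ hθ using fun F : Finset S => h F.card F le_rfl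
  let U : Ultrafilter (Finset S) := Ultrafilter.of atTop
  have eventually_mem : ∀ a b : S, ∀ᶠ F : Finset S in U, a ∈ F ∧ b ∈ F := fun a b =>
    Ultrafilter.of_le atTop <| (eventually_ge_atTop {a, b}).mono fun F hF =>
      ⟨hF (by simp), hF (by simp)⟩
  refine representable_iff.2
    ⟨∀ F, X F, fun a => BinRel.ultraproduct U fun F => θ F a, ?_, ?_, ?_⟩
  · intro a _ b _ hab
    obtain ⟨F, hF, ha, hb⟩ :=
      ((BinRel.ultraproduct_eq_ultraproduct_iff.1 hab).and (eventually_mem a b)).exists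
    exact (hθ F).injOn ha hb hF
  · intro a _ b _
    rw [← BinRel.ultraproduct_demonicJoin, BinRel.ultraproduct_eq_ultraproduct_iff]
    exact (eventually_mem a b).mono fun F hF => (hθ F).map_join a hF.1 b hF.2
  · intro a _ b _
    rw [← BinRel.ultraproduct_comp, BinRel.ultraproduct_eq_ultraproduct_iff]
    exact (eventually_mem a b).mono fun F hF => (hθ F).map_mul a hF.1 b hF.2

section Factors

variable {ι : Type*} {M : ι → Type*} [∀ i, Lang.Structure (M i)] {U : Ultrafilter ι}

theorem eventually_out_join (a b : (U : Filter ι).Product M) :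
    ∀ᶠ i in U, (join a b).out i = join (a.out i) (b.out i) :=
  (eventually_out_funMap (L := Lang) Op.add ![a, b]).mono fun _ h => h.trans (funMap_add _)

theorem eventually_out_mul (a b : (U : Filter ι).Product M) :
    ∀ᶠ i in U, (mul a b).out i = mul (a.out i) (b.out i) :=
  (eventually_out_funMap (L := Lang) Op.comp ![a, b]).mono fun _ h => h.trans (funMap_comp _)

end Factors

theorem representable_product {ι : Type v} {M : ι → Type (max u v)} [∀ i, Lang.Structure (M i)]
    {U : Ultrafilter ι} (h : ∀ k, ∀ᶠ i in U, LocallyRepresentable k (M i)) :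
    Representable ((U : Filter ι).Product M) := by
  classical
  refine representable_of_forall_locallyRepresentable fun k F hF => ?_
  have hjoin : ∀ᶠ i in U, ∀ a ∈ F, ∀ b ∈ F, (join a b).out i = join (a.out i) (b.out i) := by
    simp only [Finset.eventually_all]
    exact fun a _ b _ => eventually_out_join a b
  have hmul : ∀ᶠ i in U, ∀ a ∈ F, ∀ b ∈ F, (mul a b).out i = mul (a.out i) (b.out i) := by
    simp only [Finset.eventually_all]
    exact fun a _ b _ => eventually_out_mul a b
  obtain ⟨i, hi, hinj, hijoin, himul⟩ :=
    ((h k).and ((eventually_injOn_out F).and (hjoin.and hmul))).exists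
  obtain ⟨X, hX, θ, hθ⟩ := hi (F.image fun a => a.out i) (Finset.card_image_le.trans hF)
  rw [Finset.coe_image] at hθ
  exact ⟨X, hX, _, hθ.comp hinj hijoin himul⟩

/-- An element that is neutral for join and absorbing for composition, both from the right. -/
structure IsRightZero (o : S) : Prop where
  join_right : ∀ a, join a o = a
  mul_right : ∀ a, mul a o = o

namespace IsRepresentationOn

variable {θ : S → BinRel X} {o : S}

theorem dom_eq (hθ : IsRepresentationOn univ θ) (ho : IsRightZero o) (a : S) :
    BinRel.dom (θ a) = BinRel.dom (θ o) := by
  ext x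
  constructor
  · rintro ⟨y, hy⟩
    rw [← ho.join_right a, hθ.map_join _ trivial _ trivial] at hy
    exact hy.2.2
  · rintro ⟨y, hy⟩
    rw [← ho.mul_right a, hθ.map_mul _ trivial _ trivial] at hy
    exact hy.imp fun _ h => h.1

theorem map_join_eq_union (hθ : IsRepresentationOn univ θ) (ho : IsRightZero o) (a b : S) :
    θ (join a b) = θ a ∪ θ b := by
  rw [hθ.map_join _ trivial _ trivial, BinRel.demonicJoin, BinRel.restrict, hθ.dom_eq ho a,
    hθ.dom_eq ho b, inter_self]
  refine sep_eq_self_iff_mem_true.2 ?_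
  rintro ⟨x, y⟩ (h | h)
  exacts [hθ.dom_eq ho a ▸ ⟨y, h⟩, hθ.dom_eq ho b ▸ ⟨y, h⟩]

end IsRepresentationOn

theorem Representable.mul_self_eq_of_zigzag {S : Type u} [Lang.Structure S] (h : Representable S)
    {o : S} (ho : IsRightZero o) {n : ℕ} {e : ℕ → S}
    (hcover : ∀ k < n, join (e 0) (join (e (2 * k + 1)) (e (2 * k + 2))) =
      join (e (2 * k + 1)) (e (2 * k + 2)))
    (heven : ∀ k < n, mul (e (2 * k)) (e (2 * k + 1)) = o)
    (hodd : ∀ k < n, mul (e (2 * k + 1)) (e (2 * k)) = o)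
    (hlast : mul (e (2 * n)) (e 0) = o) : mul (e 0) (e 0) = o := by
  obtain ⟨X, θ, hθ⟩ := representable_iff.1 h
  have hcomp : ∀ a b, BinRel.comp (θ a) (θ b) = θ (mul a b) := fun a b =>
    (hθ.map_mul a trivial b trivial).symm
  refine hθ.injOn trivial trivial (subset_antisymm ?_ ?_)
  · rw [← hcomp]
    refine BinRel.comp_self_subset_of_zigzag (R := fun k => θ (e k)) (n := n)
      (fun k hk => ?_) (fun k hk => ?_) (fun k hk => ?_) ?_
    · rw [← hθ.map_join_eq_union ho, ← hcover k hk, hθ.map_join_eq_union ho]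
      exact subset_union_left
    · rw [hcomp, heven k hk]
    · rw [hcomp, hodd k hk]
    · rw [hcomp, hlast]
  · rw [← ho.join_right (mul (e 0) (e 0)), hθ.map_join_eq_union ho]
    exact subset_union_right

end Representations

section Separation

variable {α : Type*} [LE α]

/-- The pair `(K, L)` separates if, among the members of `F`, those not below `K` are all related
to those not below `L`. Such pairs are the midpoints of the partial representations below: an
element not below `K` leads into the midpoint and one not below `L` leads out of it. -/
def Separates (P : α → α → Prop) (F : Set α) (K L : α) : Prop :=
  ∀ a ∈ F, ∀ b ∈ F, ¬ a ≤ K → ¬ b ≤ L → P a b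

/-- The existence of a separating pair that witnesses the composition of `a` and `b`. -/
def Separable (P : α → α → Prop) (F : Set α) (a b : α) : Prop :=
  ∃ K L, Separates P F K L ∧ ¬ a ≤ K ∧ ¬ b ≤ L

theorem Separable.symm {P : α → α → Prop} {F : Set α} {a b : α} (h : Separable P F a b)
    (hP : ∀ {a b}, P a b → P b a) : Separable P F b a :=
  let ⟨K, L, hKL, ha, hb⟩ := h
  ⟨L, K, fun c hc d hd hcL hdK => hP (hKL d hd c hc hdK hcL), hb, ha⟩

end Separation

/-- The `(+, ∘)`-structure on pairs of an element of `α` and a truth value in which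
`(a, p) + (b, q) = (a ⊔ b, p ∨ q)` and `(a, p) ∘ (b, q) = (⊥, P a b)`. -/
@[ext]
structure PairingStructure {α : Type u} (P : α → α → Prop) : Type u where
  /-- The component in `α`. -/
  val : α
  /-- The truth value. -/
  flag : Prop

namespace PairingStructure

variable {α : Type u} [SemilatticeSup α] {P : α → α → Prop}

variable (P) in
/-- The base of the partial representation on the elements with first component in `F`. -/
inductive Point (F : Set α) : Type u
  | src
  | tgt
  | sink
  | mid (K L : α) (h : Separates P F K L)

/-- The edges of the relation representing `a`. The edges to the sink make all relations total,
so that demonic join becomes union. -/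
inductive Edge (F : Set α) (a : PairingStructure P) : Point P F → Point P F → Prop
  | sink (x) : Edge F a x .sink
  | flag : a.flag → Edge F a .src .tgt
  | left (K L h) : ¬ a.val ≤ K → Edge F a .src (.mid K L h)
  | right (K L h) : ¬ a.val ≤ L → Edge F a (.mid K L h) .tgt

/-- The relation representing `a`. -/
def rel (F : Set α) (a : PairingStructure P) : BinRel (Point P F) := {q | Edge F a q.1 q.2}

theorem rel_injective [OrderTop α] (F : Set α) : Function.Injective (rel (P := P) F) := by
  intro a b hab
  have edge_iff : ∀ x y, Edge F a x y ↔ Edge F b x y := fun x y => Set.ext_iff.1 hab (x, y)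
  have le_iff : ∀ K, a.val ≤ K ↔ b.val ≤ K := fun K => by
    have hK : Separates P F K ⊤ := fun _ _ _ _ _ h => absurd le_top h
    have left_iff : ∀ c : PairingStructure P, Edge F c .src (.mid K ⊤ hK) ↔ ¬ c.val ≤ K :=
      fun c => ⟨fun | .left _ _ _ h => h, .left _ _ _⟩
    rw [← not_iff_not, ← left_iff, ← left_iff, edge_iff]
  have flag_iff : ∀ c : PairingStructure P, Edge F c .src .tgt ↔ c.flag :=
    fun c => ⟨fun | .flag h => h, .flag⟩
  ext1
  · exact eq_of_forall_ge_iff le_iff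
  · exact propext (by rw [← flag_iff, ← flag_iff, edge_iff])

variable [OrderBot α]

instance : Lang.Structure (PairingStructure P) where
  funMap {_} f :=
    match f with
    | Op.add => fun v => ⟨(v 0).val ⊔ (v 1).val, (v 0).flag ∨ (v 1).flag⟩
    | Op.comp => fun v => ⟨⊥, P (v 0).val (v 1).val⟩
  RelMap {_} r := r.elim

theorem join_def (a b : PairingStructure P) :
    join a b = ⟨a.val ⊔ b.val, a.flag ∨ b.flag⟩ := rfl

theorem mul_def (a b : PairingStructure P) : mul a b = ⟨⊥, P a.val b.val⟩ := rfl

variable (P) in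
/-- The copy of `α` in the pairing structure, with truth value `False`. -/
def ofVal (a : α) : PairingStructure P := ⟨a, False⟩

instance : Nonempty (PairingStructure P) := ⟨ofVal P ⊥⟩

theorem join_ofVal (a b : α) : join (ofVal P a) (ofVal P b) = ofVal P (a ⊔ b) := by
  simp only [join_def, ofVal, or_self]

theorem mul_eq_ofVal_bot_iff {a b : PairingStructure P} :
    mul a b = ofVal P ⊥ ↔ ¬ P a.val b.val := by
  simp only [mul_def, ofVal, mk.injEq, true_and, eq_iff_iff, iff_false]

theorem isRightZero_ofVal_bot (hP : ∀ a, ¬ P a ⊥) : IsRightZero (ofVal P ⊥) where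
  join_right a := by simp only [join_def, ofVal, sup_bot_eq, or_false]
  mul_right a := mul_eq_ofVal_bot_iff.2 (hP a.val)

theorem edge_join_iff {F : Set α} {a b : PairingStructure P} {x y : Point P F} :
    Edge F (join a b) x y ↔ Edge F a x y ∨ Edge F b x y := by
  have not_le_iff : ∀ K, ¬ (join a b).val ≤ K ↔ ¬ a.val ≤ K ∨ ¬ b.val ≤ K := fun K => by
    rw [join_def, sup_le_iff, not_and_or]
  constructor
  · rintro (_ | h | ⟨K, L, hKL, h⟩ | ⟨K, L, hKL, h⟩)
    · exact Or.inl (.sink x)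
    · exact h.imp .flag .flag
    · exact ((not_le_iff K).1 h).imp (.left K L hKL) (.left K L hKL)
    · exact ((not_le_iff L).1 h).imp (.right K L hKL) (.right K L hKL)
  · rintro ((_ | h | ⟨K, L, hKL, h⟩ | ⟨K, L, hKL, h⟩) | (_ | h | ⟨K, L, hKL, h⟩ | ⟨K, L, hKL, h⟩))
    · exact .sink x
    · exact .flag (Or.inl h)
    · exact .left K L hKL ((not_le_iff K).2 (Or.inl h))
    · exact .right K L hKL ((not_le_iff L).2 (Or.inl h))
    · exact .sink x
    · exact .flag (Or.inr h)
    · exact .left K L hKL ((not_le_iff K).2 (Or.inr h))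
    · exact .right K L hKL ((not_le_iff L).2 (Or.inr h))

theorem rel_join (F : Set α) (a b : PairingStructure P) :
    rel F (join a b) = BinRel.demonicJoin (rel F a) (rel F b) := by
  have mem_dom : ∀ (c : PairingStructure P) x, x ∈ BinRel.dom (rel F c) :=
    fun _ x => ⟨.sink, .sink x⟩
  ext ⟨x, y⟩
  exact edge_join_iff.trans (and_iff_left ⟨mem_dom a x, mem_dom b x⟩).symm

theorem rel_mul {F : Set α} {a b : PairingStructure P} (ha : a.val ∈ F) (hb : b.val ∈ F)
    (hab : P a.val b.val → Separable P F a.val b.val) :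
    rel F (mul a b) = BinRel.comp (rel F a) (rel F b) := by
  ext ⟨x, z⟩
  constructor
  · rintro (_ | h | ⟨K, L, hKL, h⟩ | ⟨K, L, hKL, h⟩)
    · exact ⟨.sink, .sink x, .sink _⟩
    · obtain ⟨K, L, hKL, haK, hbL⟩ := hab h
      exact ⟨.mid K L hKL, .left K L hKL haK, .right K L hKL hbL⟩
    · exact absurd bot_le h
    · exact absurd bot_le h
  · rintro ⟨y, hxy, hyz⟩
    cases hyz with
    | sink => exact .sink x
    | flag => cases hxy
    | left => cases hxy
    | right K L hKL hbL =>
      cases hxy with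
      | left _ _ _ haK => exact .flag (hKL _ ha _ hb haK hbL)

theorem isRepresentationOn_rel [OrderTop α] {F : Set α}
    (hF : ∀ a ∈ F, ∀ b ∈ F, P a b → Separable P F a b) :
    IsRepresentationOn (val ⁻¹' F) (rel (P := P) F) where
  injOn := (rel_injective F).injOn
  map_join a _ b _ := rel_join F a b
  map_mul _ ha _ hb := rel_mul ha hb (hF _ ha _ hb)

end PairingStructure

/-- The sets of natural numbers that contain `0` as soon as they contain some pair
`{2 k + 1, 2 k + 2}`. The type lives in an arbitrary universe because `Representable` takes
the base in the universe of the structure. -/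
structure ClosedSet : Type u where
  /-- The underlying set. -/
  carrier : Set ℕ
  zero_mem' : ∀ k, 2 * k + 1 ∈ carrier → 2 * k + 2 ∈ carrier → 0 ∈ carrier

namespace ClosedSet

instance : SetLike ClosedSet.{u} ℕ where
  coe := carrier
  coe_injective A B h := by cases A; cases B; congr

instance : PartialOrder ClosedSet.{u} := .ofSetLike ClosedSet ℕ

instance : InfSet ClosedSet.{u} where
  sInf 𝒜 :=
    { carrier := {i | ∀ A ∈ 𝒜, i ∈ A}
      zero_mem' := fun k hodd heven A hA => A.zero_mem' k (hodd A hA) (heven A hA) }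

instance : CompleteLattice ClosedSet.{u} :=
  completeLatticeOfInf ClosedSet fun _ =>
    ⟨fun _ hA _ hi => hi _ hA, fun _ hB _ hi _ hA => hB hA hi⟩

/-- The closed set `{i}`. -/
def single (i : ℕ) : ClosedSet.{u} := ⟨{i}, fun k hodd heven => by
  simp only [mem_singleton_iff] at hodd heven
  omega⟩

/-- The complement of `{i}`, which is closed since it contains `0`. -/
def compl (i : ℕ) (hi : i ≠ 0) : ClosedSet.{u} := ⟨{i}ᶜ, fun _ _ _ => hi.symm⟩

theorem mem_single {i j : ℕ} : i ∈ single.{u} j ↔ i = j := Iff.rfl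

theorem single_injective : Function.Injective single.{u} := fun _ _ h =>
  mem_single.1 (h ▸ mem_single.2 rfl)

theorem single_le_iff {i : ℕ} {A : ClosedSet.{u}} : single i ≤ A ↔ i ∈ A :=
  singleton_subset_iff

theorem le_compl_iff {i : ℕ} {hi : i ≠ 0} {A : ClosedSet.{u}} : A ≤ compl i hi ↔ i ∉ A :=
  subset_compl_singleton_iff

theorem notMem_bot (i : ℕ) : i ∉ (⊥ : ClosedSet.{u}) := fun h =>
  (bot_le : ⊥ ≤ (⟨∅, fun _ h _ => h⟩ : ClosedSet.{u})) h

theorem single_zero_le_sup (k : ℕ) :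
    single.{u} 0 ≤ single (2 * k + 1) ⊔ single (2 * k + 2) :=
  single_le_iff.2 <| zero_mem' _ k (single_le_iff.1 le_sup_left) (single_le_iff.1 le_sup_right)

/-- The composition pattern of closed sets determined by a graph of orthogonal numbers: the atoms
`single i` and `single j` compose to zero exactly if `i` and `j` are adjacent. -/
def Pairing (G : SimpleGraph ℕ) (A B : ClosedSet.{u}) : Prop := ∃ i ∈ A, ∃ j ∈ B, ¬ G.Adj i j

variable {G : SimpleGraph ℕ}

theorem Pairing.symm {A B : ClosedSet.{u}} : Pairing G A B → Pairing G B A :=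
  fun ⟨i, hi, j, hj, h⟩ => ⟨j, hj, i, hi, fun h' => h h'.symm⟩

theorem not_pairing_bot (A : ClosedSet.{u}) : ¬ Pairing G A ⊥ :=
  fun ⟨_, _, j, hj, _⟩ => notMem_bot j hj

theorem pairing_single_iff {i j : ℕ} :
    Pairing G (single.{u} i) (single j) ↔ ¬ G.Adj i j := by
  simp only [Pairing, mem_single, exists_eq_left]

theorem separates_compl {i : ℕ} (hi : i ≠ 0) {N : ClosedSet.{u}}
    (hN : (N : Set ℕ) = G.neighborSet i) (F : Set ClosedSet.{u}) :
    Separates (Pairing G) F (compl i hi) N := by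
  intro A _ B _ hA hB
  obtain ⟨j, hjB, hjN⟩ := SetLike.not_le_iff_exists.1 hB
  refine ⟨i, not_not.1 (mt le_compl_iff.2 hA), j, hjB, fun hij => hjN ?_⟩
  rwa [← SetLike.mem_coe, hN]

end ClosedSet

/-- The orthogonality graph of the `n`-th structure: its edges are `{2 k, 2 k + 1}` for `k < n`,
and `{2 n, 0}`. -/
def zigzagGraph (n : ℕ) : SimpleGraph ℕ :=
  .fromRel fun i j => i % 2 = 0 ∧ i < 2 * n ∧ j = i + 1 ∨ i = 2 * n ∧ j = 0

section ZigzagGraph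

open ClosedSet

variable {n t : ℕ}

theorem zigzagGraph_adj {i j : ℕ} : (zigzagGraph n).Adj i j ↔
    i ≠ j ∧ ((i % 2 = 0 ∧ i < 2 * n ∧ j = i + 1 ∨ i = 2 * n ∧ j = 0) ∨
      (j % 2 = 0 ∧ j < 2 * n ∧ i = j + 1 ∨ j = 2 * n ∧ i = 0)) :=
  SimpleGraph.fromRel_adj _ _ _

theorem zigzagGraph_adj_succ {k : ℕ} (hk : k < n) : (zigzagGraph n).Adj (2 * k) (2 * k + 1) := by
  rw [zigzagGraph_adj]
  omega

theorem zigzagGraph_adj_last (hn : 0 < n) : (zigzagGraph n).Adj (2 * n) 0 := by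
  rw [zigzagGraph_adj]
  omega

theorem zigzagGraph_neighborSet_closed (hn : 1 < n) (i k : ℕ)
    (hodd : 2 * k + 1 ∈ (zigzagGraph n).neighborSet i)
    (heven : 2 * k + 2 ∈ (zigzagGraph n).neighborSet i) : 0 ∈ (zigzagGraph n).neighborSet i := by
  simp only [SimpleGraph.mem_neighborSet, zigzagGraph_adj] at *
  omega

theorem zigzagGraph_neighborSet_two_mul (ht : 0 < t) (htn : t < n) :
    (zigzagGraph n).neighborSet (2 * t) = {2 * t + 1} := by
  ext i
  simp only [SimpleGraph.mem_neighborSet, zigzagGraph_adj, mem_singleton_iff]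
  omega

/-- The closed set `{1, 3, …, 2 t - 1} ∪ {2 t + 2, 2 t + 4, …}`. -/
def cut (t : ℕ) : ClosedSet.{u} :=
  ⟨{i | i % 2 = 1 ∧ i < 2 * t ∨ i % 2 = 0 ∧ 2 * t < i}, fun k hodd heven => by
    simp only [mem_ofPred_eq] at hodd heven
    omega⟩

theorem mem_cut {i : ℕ} : i ∈ cut.{u} t ↔ i % 2 = 1 ∧ i < 2 * t ∨ i % 2 = 0 ∧ 2 * t < i := Iff.rfl

theorem adj_notMem_cut (htn : t < n) {i j : ℕ} (hij : (zigzagGraph n).Adj i j)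
    (hi : i ∉ cut.{u} t) (hj : j ∉ cut.{u} t) :
    i = 2 * t ∧ j = 2 * t + 1 ∨ i = 2 * t + 1 ∧ j = 2 * t := by
  rw [zigzagGraph_adj] at hij
  rw [mem_cut] at hi hj
  omega

theorem eq_single_of_forall_adj (ht : 0 < t) (htn : t < n) {A : ClosedSet.{u}}
    (hA : 2 * t + 1 ∈ A) (hadj : ∀ i ∈ A, (zigzagGraph n).Adj (2 * t) i) :
    A = single (2 * t + 1) :=
  le_antisymm (fun _ hi => (zigzagGraph_neighborSet_two_mul ht htn).subset (hadj _ hi))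
    (single_le_iff.2 hA)

theorem separates_cut (ht : 0 < t) (htn : t < n) {F : Set ClosedSet.{u}}
    (hF : single (2 * t + 1) ∉ F) : Separates (Pairing (zigzagGraph n)) F (cut t) (cut t) := by
  intro A hA B hB hAt hBt
  by_contra hAB
  have hadj : ∀ i ∈ A, ∀ j ∈ B, (zigzagGraph n).Adj i j := by
    simpa only [Pairing, not_exists, not_and, not_not] using hAB
  obtain ⟨i, hi, hit⟩ := SetLike.not_le_iff_exists.1 hAt
  obtain ⟨j, hj, hjt⟩ := SetLike.not_le_iff_exists.1 hBt
  rcases adj_notMem_cut.{u} htn (hadj i hi j hj) hit hjt with ⟨rfl, rfl⟩ | ⟨rfl, rfl⟩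
  · exact hF (eq_single_of_forall_adj ht htn hj (hadj _ hi) ▸ hB)
  · exact hF (eq_single_of_forall_adj ht htn hi (fun k hk => (hadj k hk _ hj).symm) ▸ hA)

theorem separable_of_ne_zero (hn : 1 < n) (F : Set ClosedSet.{u}) {A B : ClosedSet.{u}} {i j : ℕ}
    (hi : i ∈ A) (hj : j ∈ B) (hij : ¬ (zigzagGraph n).Adj i j) (hi0 : i ≠ 0) :
    Separable (Pairing (zigzagGraph n)) F A B :=
  ⟨compl i hi0, ⟨(zigzagGraph n).neighborSet i, zigzagGraph_neighborSet_closed hn i⟩,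
    separates_compl hi0 rfl F, fun h => le_compl_iff.1 h hi, fun h => hij (h hj)⟩

theorem separable_of_pairing (ht : 0 < t) (htn : t < n) {F : Set ClosedSet.{u}}
    (hF : single (2 * t + 1) ∉ F) {A B : ClosedSet.{u}} (hAB : Pairing (zigzagGraph n) A B) :
    Separable (Pairing (zigzagGraph n)) F A B := by
  have hn : 1 < n := by omega
  obtain ⟨i, hi, j, hj, hij⟩ := hAB
  rcases ne_or_eq i 0 with hi0 | rfl
  · exact separable_of_ne_zero hn F hi hj hij hi0
  rcases ne_or_eq j 0 with hj0 | rfl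
  · exact (separable_of_ne_zero hn F hj hi (fun h => hij h.symm) hj0).symm Pairing.symm
  have zero_notMem_cut : 0 ∉ cut.{u} t := by
    rw [mem_cut]
    omega
  exact ⟨cut t, cut t, separates_cut ht htn hF, fun h => zero_notMem_cut (h hi),
    fun h => zero_notMem_cut (h hj)⟩

end ZigzagGraph

/-- The `n`-th structure of the sequence of nonrepresentable structures whose ultraproducts are
representable. -/
abbrev ZigzagStructure (n : ℕ) : Type u := PairingStructure (ClosedSet.Pairing.{u} (zigzagGraph n))

namespace ZigzagStructure

open ClosedSet PairingStructure

variable {n : ℕ}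

/-- The element of `ZigzagStructure n` given by a natural number. -/
def atom (n i : ℕ) : ZigzagStructure.{u} n := ofVal _ (single i)

theorem mul_atom_eq_zero_iff {i j : ℕ} :
    mul (atom.{u} n i) (atom n j) = ofVal _ ⊥ ↔ (zigzagGraph n).Adj i j :=
  mul_eq_ofVal_bot_iff.trans (not_iff_comm.1 pairing_single_iff.symm)

theorem join_atom_zero (k : ℕ) :
    join (atom.{u} n 0) (join (atom n (2 * k + 1)) (atom n (2 * k + 2))) =
      join (atom n (2 * k + 1)) (atom n (2 * k + 2)) := by
  simp only [atom, join_ofVal, sup_eq_right.2 (single_zero_le_sup k)]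

theorem not_representable (hn : 0 < n) : ¬ Representable (ZigzagStructure.{u} n) := by
  intro h
  refine (zigzagGraph n).irrefl (mul_atom_eq_zero_iff.1 <|
    h.mul_self_eq_of_zigzag (isRightZero_ofVal_bot not_pairing_bot) (n := n) (e := atom n)
      (fun k _ => join_atom_zero k) (fun k hk => ?_) (fun k hk => ?_) ?_)
  · exact mul_atom_eq_zero_iff.2 (zigzagGraph_adj_succ hk)
  · exact mul_atom_eq_zero_iff.2 (zigzagGraph_adj_succ hk).symm
  · exact mul_atom_eq_zero_iff.2 (zigzagGraph_adj_last hn)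

theorem exists_single_notMem {F : Finset ClosedSet.{u}} (hF : F.card + 1 < n) :
    ∃ t, 0 < t ∧ t < n ∧ single (2 * t + 1) ∉ F := by
  by_contra! h
  have hcard : (Finset.Ico 1 n).card ≤ F.card :=
    Finset.card_le_card_of_injOn (fun t => single (2 * t + 1))
      (fun t ht => h t (Finset.mem_Ico.1 ht).1 (Finset.mem_Ico.1 ht).2)
      (fun s _ t _ hst => by simpa using single_injective hst)
  rw [Nat.card_Ico] at hcard
  omega

theorem locallyRepresentable {k : ℕ} (hk : k + 1 < n) :
    LocallyRepresentable k (ZigzagStructure.{u} n) := by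
  classical
  intro F hF
  have hcard : (F.image val).card ≤ F.card := Finset.card_image_le
  obtain ⟨t, ht, htn, htF⟩ := exists_single_notMem (n := n) (F := F.image val) (by omega)
  refine ⟨Point _ (F.image val), ⟨.src⟩, rel _, (isRepresentationOn_rel fun A _ B _ hAB =>
    separable_of_pairing ht htn htF hAB).mono ?_⟩
  exact fun a ha => Finset.mem_image_of_mem val ha

theorem representable_product_hyperfilter :
    Representable ((hyperfilter ℕ : Filter ℕ).Product ZigzagStructure.{u}) :=
  representable_product fun k => Nat.hyperfilter_le_atTop <|
    (eventually_gt_atTop (k + 1)).mono fun _ => locallyRepresentable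

end ZigzagStructure

end DemonicJoin

open DemonicJoin Filter in
/-- The class of representable demonic join semigroups is not finitely axiomatisable: no finite
first-order theory has exactly the representable `(+, ∘)`-structures as its models. -/
theorem mainTheorem1 :
    ¬ ∃ Ψ : DemonicJoin.Lang.Theory, Ψ.Finite ∧
      ∀ (S : Type u) [DemonicJoin.Lang.Structure S] [Nonempty S],
        (S ⊨ Ψ ↔ DemonicJoin.Representable S) := by
  rintro ⟨Ψ, hfin, hΨ⟩
  have hmodel := (hΨ _).2 ZigzagStructure.representable_product_hyperfilter
  obtain ⟨n, hn, hpos⟩ := ((eventually_model_of_finite hfin hmodel).and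
    (Nat.hyperfilter_le_atTop (eventually_gt_atTop 0))).exists
  exact ZigzagStructure.not_representable hpos ((hΨ _).1 hn)
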